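/- Let $n\ge 1$ be an integer and let $M,L>0$. For $m>0$ let $$\Sigma_{M,L}(m)=\inf_F\int_{\mathbb{R}^n}|\xi|^2F(\xi)\,d\xi ,$$ where the infimum is taken over all locally Lipschitz functions $F:\mathbb{R}^n\to\mathbb{R}$ such that $$0\le F(\xi)\le M\ \text{ for all }\xi,\qquad \int_{\mathbb{R}^n}F(\xi)\,d\xi=m,\qquad |\nabla F(\xi)|\le L\ \text{ for almost every }\xi .$$ Let $\omega_n$ denote the volume of the unit ball of $\mathbb{R}^n$. Then $\Sigma_{M,L}(m)<\infty$ for every $m>0$, and, for fixed $n$, $M$ and $L$, as $m\to\infty$ (through the real numbers, in particular through the integers), $$\Sigma_{M,L}(m)=\frac{n}{n+2}\Bigl(\frac1{\omega_nM}\Bigr)^{2/n}m^{1+2/n}+\frac{n}{12}\,\frac{M^2}{L^2}\,m-\frac{n(n-1)(3n+2)}{1440}\,\frac{M^4(M\omega_n)^{2/n}}{L^4}\,m^{1-2/n}+O\bigl(m^{1-4/n}\bigr).$$ For every $n\ge1$ the second term is linear in $m$ with a positive coefficient, and it is positive for $m>0$. The third term (with its sign) is negative for all $m>0$ if $n\ge2$,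 and it vanishes if $n=1$. -/

import Mathlib

open MeasureTheory Filter Asymptotics

/-- The volume of the unit ball of `ℝⁿ`. -/
noncomputable def omegaBall (n : ℕ) : ℝ :=
  (volume (Metric.ball (0 : EuclideanSpace ℝ (Fin n)) 1)).toReal

/-- The admissible functions of the minimization problem:
`0 ≤ F ≤ M`, `∫ F = m` and `|∇F| ≤ L`. The gradient condition is the usual one for Lipschitz
functions: by Rademacher's theorem a locally Lipschitz function is differentiable almost
everywhere, so that the bound on the gradient is meaningful almost everywhere. -/
structure IsAdmissible (n : ℕ) (M L m : ℝ) (F : EuclideanSpace ℝ (Fin n) → ℝ) : Prop where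
  nonneg : ∀ ξ, 0 ≤ F ξ
  le_bound : ∀ ξ, F ξ ≤ M
  integrable : Integrable F volume
  integral_eq : ∫ ξ, F ξ = m
  locallyLipschitz : LocallyLipschitz F
  norm_gradient_le : ∀ᵐ ξ ∂volume, ‖gradient F ξ‖ ≤ L

/-- The infimum of `∫ |ξ|² F(ξ) dξ` over the admissible functions `F`, with values in `[0, ∞]`
(the integrand is nonnegative, and its integral may be infinite for some admissible `F`). -/
noncomputable def sigmaInf (n : ℕ) (M L m : ℝ) : ENNReal :=
  ⨅ (F : EuclideanSpace ℝ (Fin n) → ℝ) (_ : IsAdmissible n M L m F),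
    ∫⁻ ξ, ENNReal.ofReal (‖ξ‖ ^ 2 * F ξ)

/-- The first term of the expansion. -/
noncomputable def leadingTerm (n : ℕ) (M m : ℝ) : ℝ :=
  (n : ℝ) / ((n : ℝ) + 2) * (1 / (omegaBall n * M)) ^ (2 / (n : ℝ)) * m ^ (1 + 2 / (n : ℝ))

/-- The second term of the expansion. -/
noncomputable def secondTerm (n : ℕ) (M L m : ℝ) : ℝ :=
  (n : ℝ) / 12 * (M ^ 2 / L ^ 2) * m

/-- The third term of the expansion, with its sign. -/
noncomputable def thirdTerm (n : ℕ) (M L m : ℝ) : ℝ :=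
  -((n : ℝ) * ((n : ℝ) - 1) * (3 * (n : ℝ) + 2) / 1440
    * (M ^ 4 * (M * omegaBall n) ^ (2 / (n : ℝ)) / L ^ 4) * m ^ (1 - 2 / (n : ℝ)))

/-- The three-term approximation `Σ₀(m)`. -/
noncomputable def sigmaZero (n : ℕ) (M L m : ℝ) : ℝ :=
  leadingTerm n M m + secondTerm n M L m + thirdTerm n M L m

/-!
The minimizer is the truncated cone `T ξ = L * max 0 (R - max r ‖ξ‖)` with `L * (R - r) = M`, the
radius `R` being fixed by the mass (`sigmaInf_eq`). Its optimality is proved by calibration rather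
than by rearrangement. Choose `s ∈ [r, R]` such that `‖ξ‖ ^ 2 - s ^ 2` has integral zero over the
annulus `r ≤ ‖ξ‖ ≤ R`. Since `F` and `T` have the same mass,
`∫ ‖ξ‖ ^ 2 * (F - T) = ∫ (‖ξ‖ ^ 2 - s ^ 2) * (F - T)`. For `‖ξ‖ < r` the weight is nonpositive
and `F ≤ M = T`; for `‖ξ‖ > R` it is nonnegative and `F ≥ 0 = T`. On the annulus `T` decreases
along rays with slope exactly `-L`, the steepest allowed, so `F - T` is nondecreasing along almost
every ray, while the weight changes sign from negative to positive at `‖ξ‖ = s`. Hence the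
integrand is at least the weight times `c θ`, the value of `F - T` at `s • θ`, where
`θ = ξ / ‖ξ‖` (`calibration_le`). In polar coordinates the integral of this minorant is the product
of `∫ c` and the integral of the weight over the annulus, which vanishes
(`integral_mul_radial_eq_zero`).

Only the monotonicity along almost every ray is needed of the gradient bound. It follows from
Rademacher's theorem, polar coordinates, and the fundamental theorem of calculus for the absolutely
continuous restriction of `F` to a ray (`ae_sub_le_mul_sub`).

The mass and the energy of `T` are explicit polynomials in the mean radius `x = (R + r) / 2` and
the half-width `a = M / (2 * L)` of the annulus. With `t = a / x` and
`S k t = ((1 + t) ^ k - (1 - t) ^ k) / (2 * k * t)` they are `ω * M * x ^ n * S (n + 1) t` and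
`n / (n + 2) * (ω * M * x ^ (n + 2)) * S (n + 3) t`. The expansion of the energy in powers of the
mass thus becomes an identity between Taylor coefficients in `t ^ 2` up to `O(t ^ 6)`
(`energy_expansion_isBigO`). It is transported to the variable `m` because, by the intermediate
value theorem, every large `m` is the mass of some `T`.
-/

/-! ### The truncated cone: regularity, mass and energy -/

section TruncatedCone

variable {E : Type*} [NormedAddCommGroup E]

/-- The radial function equal to `l * (R - r)` for `‖ξ‖ ≤ r`, to zero for `‖ξ‖ ≥ R`, and decreasing
with slope `-l` along rays in between, provided that `r ≤ R`. -/
noncomputable def truncCone (l r R : ℝ) (ξ : E) : ℝ :=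
  l * max 0 (R - max r ‖ξ‖)

theorem truncCone_nonneg {l : ℝ} (hl : 0 ≤ l) (r R : ℝ) (ξ : E) : 0 ≤ truncCone l r R ξ :=
  mul_nonneg hl (le_max_left _ _)

theorem truncCone_le {l r R : ℝ} (hl : 0 ≤ l) (hrR : r ≤ R) (ξ : E) :
    truncCone l r R ξ ≤ l * (R - r) :=
  mul_le_mul_of_nonneg_left (max_le (sub_nonneg.2 hrR) (sub_le_sub_left (le_max_left _ _) _)) hl

theorem truncCone_of_norm_le {l r R : ℝ} (hrR : r ≤ R) {ξ : E} (h : ‖ξ‖ ≤ r) :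
    truncCone l r R ξ = l * (R - r) := by
  rw [truncCone, max_eq_left h, max_eq_right (sub_nonneg.2 hrR)]

theorem truncCone_of_mem_Icc {l r R : ℝ} {ξ : E} (h₁ : r ≤ ‖ξ‖) (h₂ : ‖ξ‖ ≤ R) :
    truncCone l r R ξ = l * (R - ‖ξ‖) := by
  rw [truncCone, max_eq_right h₁, max_eq_right (sub_nonneg.2 h₂)]

theorem truncCone_of_le_norm {l r R : ℝ} {ξ : E} (h : R ≤ ‖ξ‖) :
    truncCone l r R ξ = 0 := by
  rw [truncCone, max_eq_left (sub_nonpos.2 (h.trans (le_max_right _ _))), mul_zero]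

theorem lipschitzWith_truncCone (l : NNReal) (r R : ℝ) :
    LipschitzWith l (truncCone (E := E) l r R) := by
  have h : LipschitzWith 1 fun ξ : E => max 0 (R - max r ‖ξ‖) :=
    ((((LipschitzWith.const R).sub (lipschitzWith_one_norm.const_max r)).const_max 0)).weaken
      (by simp)
  refine LipschitzWith.of_dist_le_mul fun x y => ?_
  have := h.dist_le_mul x y
  rw [Real.dist_eq] at this ⊢
  rw [truncCone, truncCone, ← mul_sub, abs_mul, NNReal.abs_eq]
  exact mul_le_mul_of_nonneg_left (by simpa using this) l.2

theorem continuous_truncCone (l r R : ℝ) : Continuous (truncCone (E := E) l r R) := by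
  unfold truncCone; fun_prop

theorem hasCompactSupport_truncCone [ProperSpace E] (l r R : ℝ) :
    HasCompactSupport (truncCone (E := E) l r R) :=
  HasCompactSupport.intro (isCompact_closedBall 0 R) fun ξ hξ =>
    truncCone_of_le_norm (by simpa using hξ : R < ‖ξ‖).le

theorem integral_pow_mul_trapezoid (k : ℕ) (l : ℝ) {r R : ℝ} (hr : 0 ≤ r) (hrR : r ≤ R) :
    ∫ y in Set.Ioi (0 : ℝ), y ^ k * (l * max 0 (R - max r y))
      = l * (R ^ (k + 2) - r ^ (k + 2)) / ((k + 1) * (k + 2)) := by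
  have h0 : ∫ y in Set.Ioi (0 : ℝ), y ^ k * (l * max 0 (R - max r y))
      = ∫ y in (0 : ℝ)..R, y ^ k * (l * max 0 (R - max r y)) := by
    rw [intervalIntegral.integral_of_le (hr.trans hrR)]
    refine setIntegral_eq_of_subset_of_forall_sdiff_eq_zero measurableSet_Ioi
      Set.Ioc_subset_Ioi_self fun y hy => ?_
    have : R < y := by
      by_contra h
      exact hy.2 ⟨hy.1, not_lt.1 h⟩
    rw [max_eq_left (sub_nonpos.2 (this.le.trans (le_max_right _ _)))]
    simp
  have hc : Continuous fun y : ℝ => y ^ k * (l * max 0 (R - max r y)) := by fun_prop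
  rw [h0, ← intervalIntegral.integral_add_adjacent_intervals (hc.intervalIntegrable 0 r)
    (hc.intervalIntegrable r R)]
  have h1 : ∫ y in (0 : ℝ)..r, y ^ k * (l * max 0 (R - max r y))
      = ∫ y in (0 : ℝ)..r, y ^ k * (l * (R - r)) := by
    refine intervalIntegral.integral_congr fun y hy => ?_
    rw [Set.uIcc_of_le hr] at hy
    simp only [max_eq_left hy.2, max_eq_right (sub_nonneg.2 hrR)]
  have h2 : ∫ y in r..R, y ^ k * (l * max 0 (R - max r y))
      = ∫ y in r..R, (l * R * y ^ k - l * y ^ (k + 1)) := by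
    refine intervalIntegral.integral_congr fun y hy => ?_
    rw [Set.uIcc_of_le hrR] at hy
    simp only [max_eq_right hy.1, max_eq_right (sub_nonneg.2 hy.2)]
    ring
  rw [h1, h2, intervalIntegral.integral_mul_const, intervalIntegral.integral_sub
    (Continuous.intervalIntegrable (by fun_prop) _ _)
    (Continuous.intervalIntegrable (by fun_prop) _ _),
    intervalIntegral.integral_const_mul, intervalIntegral.integral_const_mul,
    integral_pow, integral_pow, integral_pow]
  push_cast
  field_simp
  ring

variable [InnerProductSpace ℝ E] [FiniteDimensional ℝ E]

theorem norm_gradient_truncCone_le {l : ℝ} (hl : 0 ≤ l) (r R : ℝ) (ξ : E) :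
    ‖gradient (truncCone l r R) ξ‖ ≤ l := by
  rw [gradient, LinearIsometryEquiv.norm_map]
  exact norm_fderiv_le_of_lipschitz ℝ (lipschitzWith_truncCone ⟨l, hl⟩ r R)

variable [MeasurableSpace E] [BorelSpace E]

theorem integrable_truncCone (l r R : ℝ) : Integrable (truncCone (E := E) l r R) :=
  (continuous_truncCone l r R).integrable_of_hasCompactSupport (hasCompactSupport_truncCone l r R)

theorem integrable_norm_sq_mul_truncCone (l r R : ℝ) :
    Integrable fun ξ : E => ‖ξ‖ ^ 2 * truncCone l r R ξ :=
  Continuous.integrable_of_hasCompactSupport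
    (by have := continuous_truncCone (E := E) l r R; fun_prop)
    (hasCompactSupport_truncCone l r R).mul_left

theorem integral_truncCone [Nontrivial E] (l : ℝ) {r R : ℝ} (hr : 0 ≤ r) (hrR : r ≤ R) :
    ∫ ξ : E, truncCone l r R ξ
      = volume.real (Metric.ball (0 : E) 1) * l *
        (R ^ (Module.finrank ℝ E + 1) - r ^ (Module.finrank ℝ E + 1)) /
          (Module.finrank ℝ E + 1) := by
  have h := integral_fun_norm_addHaar (volume : Measure E) fun y => l * max 0 (R - max r y)
  obtain ⟨d, hd⟩ := Nat.exists_eq_add_of_lt (Module.finrank_pos (R := ℝ) (M := E))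
  simp only [smul_eq_mul, nsmul_eq_mul, hd, zero_add, Nat.add_sub_cancel] at h ⊢
  rw [integral_pow_mul_trapezoid d l hr hrR] at h
  refine h.trans ?_
  push_cast
  field_simp
  ring

theorem integral_norm_sq_mul_truncCone [Nontrivial E] (l : ℝ) {r R : ℝ} (hr : 0 ≤ r)
    (hrR : r ≤ R) :
    ∫ ξ : E, ‖ξ‖ ^ 2 * truncCone l r R ξ
      = volume.real (Metric.ball (0 : E) 1) * l * Module.finrank ℝ E *
        (R ^ (Module.finrank ℝ E + 3) - r ^ (Module.finrank ℝ E + 3)) /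
          ((Module.finrank ℝ E + 2) * (Module.finrank ℝ E + 3)) := by
  have h := integral_fun_norm_addHaar (volume : Measure E)
    fun y => y ^ 2 * (l * max 0 (R - max r y))
  obtain ⟨d, hd⟩ := Nat.exists_eq_add_of_lt (Module.finrank_pos (R := ℝ) (M := E))
  simp only [smul_eq_mul, nsmul_eq_mul, hd, zero_add, Nat.add_sub_cancel, ← mul_assoc, ← pow_add]
    at h ⊢
  have h' := integral_pow_mul_trapezoid (d + 2) l hr hrR
  simp only [← mul_assoc] at h'
  rw [h'] at h
  simp only [truncCone, ← mul_assoc]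
  refine h.trans ?_
  push_cast
  field_simp
  ring

end TruncatedCone

theorem isAdmissible_truncCone {n : ℕ} (hn : 1 ≤ n) {M L l r R : ℝ} (hl : 0 ≤ l) (hlL : l ≤ L)
    (hr : 0 ≤ r) (hrR : r ≤ R) (hM : l * (R - r) ≤ M) :
    IsAdmissible n M L (omegaBall n * l * (R ^ (n + 1) - r ^ (n + 1)) / (n + 1))
      (truncCone l r R) where
  nonneg := truncCone_nonneg hl r R
  le_bound ξ := (truncCone_le hl hrR ξ).trans hM
  integrable := integrable_truncCone l r R
  integral_eq := by
    have : Nonempty (Fin n) := ⟨⟨0, hn⟩⟩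
    rw [integral_truncCone l hr hrR, finrank_euclideanSpace_fin]
    rfl
  locallyLipschitz := (lipschitzWith_truncCone ⟨l, hl⟩ r R).locallyLipschitz
  norm_gradient_le := .of_forall fun ξ => (norm_gradient_truncCone_le hl r R ξ).trans hlL

theorem lintegral_truncCone {n : ℕ} (hn : 1 ≤ n) {l r R : ℝ} (hl : 0 ≤ l)
    (hr : 0 ≤ r) (hrR : r ≤ R) :
    ∫⁻ ξ : EuclideanSpace ℝ (Fin n), ENNReal.ofReal (‖ξ‖ ^ 2 * truncCone l r R ξ)
      = ENNReal.ofReal (omegaBall n * l * n * (R ^ (n + 3) - r ^ (n + 3)) /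
          ((n + 2) * (n + 3))) := by
  have : Nonempty (Fin n) := ⟨⟨0, hn⟩⟩
  rw [← ofReal_integral_eq_lintegral_ofReal (integrable_norm_sq_mul_truncCone l r R)
    (.of_forall fun ξ => mul_nonneg (sq_nonneg _) (truncCone_nonneg hl r R ξ)),
    integral_norm_sq_mul_truncCone l hr hrR, finrank_euclideanSpace_fin]
  rfl

theorem omegaBall_pos (n : ℕ) : 0 < omegaBall n :=
  ENNReal.toReal_pos (Metric.measure_ball_pos _ _ one_pos).ne' measure_ball_lt_top.ne

/-- For every mass there is an admissible cone (`r = 0`): a large radius `R` makes both its slope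
and its height small. -/
theorem sigmaInf_ne_top {n : ℕ} (hn : 1 ≤ n) {M L m : ℝ} (hM : 0 < M) (hL : 0 < L) (hm : 0 < m) :
    sigmaInf n M L m ≠ ⊤ := by
  have hω := omegaBall_pos n
  set K : ℝ := m * (n + 1) / omegaBall n with hK
  have hKpos : 0 < K := by positivity
  obtain ⟨R, hR1, hRM, hRL⟩ : ∃ R : ℝ, 1 ≤ R ∧ K / M ≤ R ∧ K / L ≤ R :=
    ⟨max 1 (max (K / M) (K / L)), le_max_left _ _, (le_max_left _ _).trans (le_max_right _ _),
      (le_max_right _ _).trans (le_max_right _ _)⟩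
  have hR0 : 0 < R := one_pos.trans_le hR1
  have hRn : R ≤ R ^ n := le_self_pow₀ hR1 (by omega)
  have hl : 0 ≤ K / R ^ (n + 1) := by positivity
  have hM' : K / R ^ (n + 1) * (R - 0) ≤ M := by
    rw [sub_zero, pow_succ, div_mul_eq_mul_div, mul_div_mul_right _ _ hR0.ne',
      div_le_iff₀ (by positivity)]
    rw [div_le_iff₀ hM] at hRM
    nlinarith
  have hL' : K / R ^ (n + 1) ≤ L := by
    rw [div_le_iff₀ (by positivity), pow_succ]
    rw [div_le_iff₀ hL] at hRL
    have : R ≤ R ^ n * R := hRn.trans (le_mul_of_one_le_right (by positivity) hR1)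
    nlinarith
  have hA := isAdmissible_truncCone hn hl hL' le_rfl hR0.le hM'
  have hmass : omegaBall n * (K / R ^ (n + 1)) * (R ^ (n + 1) - 0 ^ (n + 1)) / (n + 1) = m := by
    rw [zero_pow (by omega), hK]
    field_simp
    simp
  rw [hmass] at hA
  refine ne_top_of_le_ne_top ?_ (iInf₂_le _ hA)
  rw [lintegral_truncCone hn hl le_rfl hR0.le]
  exact ENNReal.ofReal_ne_top

/-! ### Polar coordinates -/

section Polar

variable {E : Type*} [NormedAddCommGroup E] [NormedSpace ℝ E] [FiniteDimensional ℝ E]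
  [MeasurableSpace E] [BorelSpace E] (μ : Measure E) [μ.IsAddHaarMeasure]

/-- A property that holds almost everywhere holds, on almost every ray from the origin, at almost
every point of the ray. -/
theorem ae_toSphere_ae_of_ae {p : E → Prop} (h : ∀ᵐ ξ ∂μ, p ξ) :
    ∀ᵐ θ : Metric.sphere (0 : E) 1 ∂μ.toSphere, ∀ᵐ ρ : ℝ, 0 < ρ → p (ρ • (θ : E)) := by
  have hemb : MeasurableEmbedding (Subtype.val : ({0}ᶜ : Set E) → E) :=
    .subtype_coe (measurableSet_singleton 0).compl
  have h1 : ∀ᵐ x : ({0}ᶜ : Set E) ∂μ.comap (Subtype.val : ({0}ᶜ : Set E) → E), p x := by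
    rw [← hemb.ae_map_iff, hemb.map_comap]
    exact ae_restrict_of_ae h
  have h2 := (Measure.measurePreserving_homeomorphUnitSphereProd μ).symm
    (homeomorphUnitSphereProd E).toMeasurableEquiv |>.quasiMeasurePreserving.ae h1
  filter_upwards [Measure.ae_ae_of_ae_prod h2] with θ hθ
  rw [Measure.volumeIoiPow, ae_withDensity_iff (by fun_prop)] at hθ
  have hemb' : MeasurableEmbedding (Subtype.val : Set.Ioi (0 : ℝ) → ℝ) :=
    .subtype_coe measurableSet_Ioi
  have h3 : ∀ᵐ ρ : Set.Ioi (0 : ℝ) ∂(Measure.comap (Subtype.val : Set.Ioi (0 : ℝ) → ℝ) volume),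
      p (ρ.1 • (θ : E)) := by
    filter_upwards [hθ] with ρ hρ
    exact hρ (by simpa using pow_pos ρ.2 _)
  rw [← hemb'.ae_map_iff (p := fun ρ => p (ρ • (θ : E))), hemb'.map_comap,
    Subtype.range_coe, ae_restrict_iff' measurableSet_Ioi] at h3
  exact h3

theorem ae_of_ae_toSphere [Nontrivial E] {p : E → Prop}
    (h : ∀ᵐ θ : Metric.sphere (0 : E) 1 ∂μ.toSphere, p θ) :
    ∀ᵐ ξ ∂μ, ξ ≠ 0 ∧ p (‖ξ‖⁻¹ • ξ) := by
  have hemb : MeasurableEmbedding (Subtype.val : ({0}ᶜ : Set E) → E) :=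
    .subtype_coe (measurableSet_singleton 0).compl
  have h2 := (Measure.measurePreserving_homeomorphUnitSphereProd μ).quasiMeasurePreserving.ae
    (Measure.quasiMeasurePreserving_fst.ae h)
  have h3 : ∀ᵐ x : ({0}ᶜ : Set E) ∂μ.comap (Subtype.val : ({0}ᶜ : Set E) → E),
      (fun ξ : E => ξ ≠ 0 ∧ p (‖ξ‖⁻¹ • ξ)) x := by
    filter_upwards [h2] with x hx
    exact ⟨x.2, by simpa using hx⟩
  rwa [← hemb.ae_map_iff (p := fun ξ : E => ξ ≠ 0 ∧ p (‖ξ‖⁻¹ • ξ)), hemb.map_comap,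
    Subtype.range_coe, restrict_compl_singleton] at h3

theorem integral_mul_radial [Nontrivial E] (k : ℝ → ℝ) (g : E → ℝ) :
    ∫ ξ, k ‖ξ‖ * g (‖ξ‖⁻¹ • ξ) ∂μ
      = (∫ ρ, k ρ.1 ∂(Measure.volumeIoiPow (Module.finrank ℝ E - 1))) *
        ∫ θ, g θ ∂μ.toSphere := by
  have h1 : ∫ ξ, k ‖ξ‖ * g (‖ξ‖⁻¹ • ξ) ∂μ
      = ∫ x : ({(0)}ᶜ : Set E), k ‖x.1‖ * g (‖x.1‖⁻¹ • x.1) ∂(μ.comap (↑)) := by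
    rw [integral_subtype_comap (measurableSet_singleton _).compl
      fun ξ : E => k ‖ξ‖ * g (‖ξ‖⁻¹ • ξ), restrict_compl_singleton]
  have h2 := μ.measurePreserving_homeomorphUnitSphereProd.integral_comp
    (Homeomorph.measurableEmbedding _) fun z => g z.1 * k z.2.1
  rw [integral_prod_mul (fun θ : Metric.sphere (0 : E) 1 => g θ)
    (fun ρ : Set.Ioi (0 : ℝ) => k ρ.1)] at h2
  rw [h1, mul_comm, ← h2]
  refine integral_congr_ae (.of_forall fun x => ?_)
  simp [mul_comm]

/-- A radial weight of total integral zero also integrates to zero against a function of the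
direction alone. -/
theorem integral_mul_radial_eq_zero [Nontrivial E] {k : ℝ → ℝ} (hk : ∫ ξ, k ‖ξ‖ ∂μ = 0)
    (g : E → ℝ) : ∫ ξ, k ‖ξ‖ * g (‖ξ‖⁻¹ • ξ) ∂μ = 0 := by
  have h := integral_mul_radial μ k fun _ => 1
  simp only [mul_one, hk, integral_const, smul_eq_mul] at h
  have hne : μ.toSphere.real Set.univ ≠ 0 := by
    rw [measureReal_def, ENNReal.toReal_ne_zero]
    exact ⟨Measure.measure_univ_ne_zero.2 μ.toSphere_ne_zero, measure_ne_top _ _⟩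
  rw [integral_mul_radial, (mul_eq_zero.1 h.symm).resolve_right hne, zero_mul]

end Polar

/-! ### Monotonicity along rays -/

/-- Rademacher's theorem for locally Lipschitz functions. -/
theorem LocallyLipschitz.ae_differentiableAt {E F : Type*} [NormedAddCommGroup E]
    [NormedSpace ℝ E] [FiniteDimensional ℝ E] [MeasurableSpace E] [BorelSpace E]
    [NormedAddCommGroup F] [NormedSpace ℝ F] [FiniteDimensional ℝ F] {μ : Measure E}
    [μ.IsAddHaarMeasure] {f : E → F} (hf : LocallyLipschitz f) :
    ∀ᵐ x ∂μ, DifferentiableAt ℝ f x := by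
  have h : ∀ k : ℕ, ∀ᵐ x ∂μ, x ∈ Metric.closedBall (0 : E) k →
      DifferentiableWithinAt ℝ f (Metric.closedBall (0 : E) k) x := fun k => by
    obtain ⟨K, hK⟩ := (hf.locallyLipschitzOn (s := Metric.closedBall (0 : E) k)
      ).exists_lipschitzOnWith_of_compact (isCompact_closedBall _ _)
    exact hK.ae_differentiableWithinAt_of_mem
  filter_upwards [ae_all_iff.2 h] with x hx
  obtain ⟨k, hk⟩ := exists_nat_gt ‖x‖
  exact (hx k (by simpa using hk.le)).differentiableAt
    (Metric.closedBall_mem_nhds_of_mem (by simpa using hk))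

section Radial

/-- The pointwise inequality behind the optimality of the truncated cone. It uses that
`L * (R - s)` is the value of the truncated cone at the point of norm `s` on the ray through `ξ`. -/
theorem calibration_le {E : Type*} [NormedAddCommGroup E] [NormedSpace ℝ E] {L r R s : ℝ}
    {F : E → ℝ} {ξ : E} (hr : 0 ≤ r) (hrs : r ≤ s) (hsR : s ≤ R) (h0 : 0 ≤ F ξ)
    (hle : F ξ ≤ L * (R - r)) (hξ : ξ ≠ 0)
    (hF : ∀ a b : ℝ, 0 ≤ a → a ≤ b →
      F (a • ‖ξ‖⁻¹ • ξ) - F (b • ‖ξ‖⁻¹ • ξ) ≤ L * (b - a)) :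
    (Set.Icc r R).indicator (fun ρ => ρ ^ 2 - s ^ 2) ‖ξ‖ *
        (F (s • ‖ξ‖⁻¹ • ξ) - L * (R - s))
      ≤ (‖ξ‖ ^ 2 - s ^ 2) * (F ξ - truncCone L r R ξ) := by
  have hρ := norm_nonneg ξ
  have hself : F (‖ξ‖ • ‖ξ‖⁻¹ • ξ) = F ξ := by rw [smul_inv_smul₀ (norm_ne_zero_iff.2 hξ)]
  rcases lt_or_ge ‖ξ‖ r with h | h
  · rw [Set.indicator_of_notMem (fun hm => h.not_ge hm.1), zero_mul,
      truncCone_of_norm_le (hrs.trans hsR) h.le]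
    exact mul_nonneg_of_nonpos_of_nonpos
      (sub_nonpos.2 (pow_le_pow_left₀ hρ (h.le.trans hrs) 2)) (sub_nonpos.2 hle)
  rcases lt_or_ge R ‖ξ‖ with h' | h'
  · rw [Set.indicator_of_notMem (fun hm => h'.not_ge hm.2), zero_mul,
      truncCone_of_le_norm h'.le, sub_zero]
    exact mul_nonneg (sub_nonneg.2 (pow_le_pow_left₀ (hr.trans hrs) (hsR.trans h'.le) 2)) h0
  rw [Set.indicator_of_mem (show ‖ξ‖ ∈ Set.Icc r R from ⟨h, h'⟩),
    truncCone_of_mem_Icc h h', ← sub_nonneg, ← mul_sub]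
  rcases le_total ‖ξ‖ s with hs | hs
  · refine mul_nonneg_of_nonpos_of_nonpos (sub_nonpos.2 (pow_le_pow_left₀ hρ hs 2)) ?_
    have := hF _ _ hρ hs
    rw [hself] at this
    linarith
  · refine mul_nonneg (sub_nonneg.2 (pow_le_pow_left₀ (hr.trans hrs) hs 2)) ?_
    have := hF _ _ (hr.trans hrs) hs
    rw [hself] at this
    linarith

variable {E : Type*} [NormedAddCommGroup E] [InnerProductSpace ℝ E] [FiniteDimensional ℝ E]

/-- If the gradient of `F` is bounded by `L` at almost every point of a ray, then `F` decreases along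
the ray with slope at least `-L`. The restriction to a segment is Lipschitz, hence the integral of
its derivative. -/
theorem sub_le_mul_sub_of_ae_norm_gradient_le {F : E → ℝ} {L : ℝ} (hF : LocallyLipschitz F)
    {θ : E} (hθ : ‖θ‖ = 1)
    (h : ∀ᵐ ρ : ℝ, 0 < ρ → DifferentiableAt ℝ F (ρ • θ) ∧ ‖gradient F (ρ • θ)‖ ≤ L)
    {a b : ℝ} (ha : 0 ≤ a) (hab : a ≤ b) : F (a • θ) - F (b • θ) ≤ L * (b - a) := by
  have hlip : LipschitzWith 1 fun ρ : ℝ => ρ • θ :=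
    LipschitzWith.of_dist_le_mul fun x y => by
      simp [dist_eq_norm, ← sub_smul, norm_smul, hθ]
  have hloc : LocallyLipschitz fun ρ : ℝ => F (ρ • θ) := hF.comp hlip.locallyLipschitz
  obtain ⟨K, hK⟩ := (hloc.locallyLipschitzOn (s := Set.uIcc a b)
    ).exists_lipschitzOnWith_of_compact isCompact_uIcc
  have hac := hK.absolutelyContinuousOnInterval
  have hint := hac.integral_deriv_eq_sub
  have hle : ∫ ρ in a..b, -L ≤ ∫ ρ in a..b, deriv (fun ρ : ℝ => F (ρ • θ)) ρ := by
    refine intervalIntegral.integral_mono_ae_restrict hab intervalIntegrable_const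
      hac.intervalIntegrable_deriv ?_
    rw [EventuallyLE, ← restrict_Ioc_eq_restrict_Icc, ae_restrict_iff' measurableSet_Ioc]
    filter_upwards [h] with ρ hρ hmem
    obtain ⟨hd, hL⟩ := hρ (ha.trans_lt hmem.1)
    have hderiv : HasDerivAt (fun ρ : ℝ => F (ρ • θ)) (fderiv ℝ F (ρ • θ) θ) ρ := by
      have := hd.hasFDerivAt.comp_hasDerivAt ρ ((hasDerivAt_id ρ).smul_const θ)
      simpa [Function.comp_def] using this
    rw [hderiv.deriv]
    have h1 := (fderiv ℝ F (ρ • θ)).le_opNorm θ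
    rw [hθ, mul_one, Real.norm_eq_abs] at h1
    rw [gradient, LinearIsometryEquiv.norm_map] at hL
    exact (neg_le_neg hL).trans ((neg_le_neg h1).trans (neg_abs_le _))
  rw [hint, intervalIntegral.integral_const, smul_eq_mul] at hle
  linarith

variable [MeasurableSpace E] [BorelSpace E] [Nontrivial E]

theorem ae_sub_le_mul_sub {F : E → ℝ} {L : ℝ} (hF : LocallyLipschitz F)
    (h : ∀ᵐ ξ, ‖gradient F ξ‖ ≤ L) :
    ∀ᵐ ξ : E, ξ ≠ 0 ∧ ∀ a b : ℝ, 0 ≤ a → a ≤ b →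
      F (a • ‖ξ‖⁻¹ • ξ) - F (b • ‖ξ‖⁻¹ • ξ) ≤ L * (b - a) := by
  refine ae_of_ae_toSphere volume (p := fun θ => ∀ a b : ℝ, 0 ≤ a → a ≤ b →
      F (a • θ) - F (b • θ) ≤ L * (b - a)) ?_
  filter_upwards [ae_toSphere_ae_of_ae volume (hF.ae_differentiableAt.and h)] with θ hθ a b ha hab
  exact sub_le_mul_sub_of_ae_norm_gradient_le hF (by simp) hθ ha hab

/-! ### Optimality of the truncated cone -/

/-- The square of the calibration radius `s` is the average of `‖ξ‖ ^ 2` over the annulus. -/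
theorem exists_integral_annulus_eq_zero {r R : ℝ} (hr : 0 ≤ r) (hrR : r < R) :
    ∃ s, r ≤ s ∧ s ≤ R ∧
      ∫ ξ : E, (Set.Icc r R).indicator (fun ρ => ρ ^ 2 - s ^ 2) ‖ξ‖ = 0 := by
  set A : Set E := (fun ξ => ‖ξ‖) ⁻¹' Set.Icc r R with hA
  have hAm : MeasurableSet A := measurable_norm measurableSet_Icc
  have hA0 : volume A ≠ 0 := by
    obtain ⟨ξ, hξ⟩ := exists_norm_eq E (c := (r + R) / 2) (by linarith)
    have hopen : IsOpen ((fun ξ : E => ‖ξ‖) ⁻¹' Set.Ioo r R) := isOpen_Ioo.preimage continuous_norm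
    refine ((hopen.measure_pos volume ⟨ξ, ?_⟩).trans_le
      (measure_mono (Set.preimage_mono Set.Ioo_subset_Icc_self))).ne'
    simp only [Set.mem_preimage, hξ, Set.mem_Ioo]
    constructor <;> linarith
  have hAsub : A ⊆ Metric.closedBall 0 R := fun ξ hξ => by simpa using hξ.2
  have hAtop : volume A ≠ ⊤ :=
    ne_top_of_le_ne_top measure_closedBall_lt_top.ne (measure_mono hAsub)
  have hint : IntegrableOn (fun ξ : E => ‖ξ‖ ^ 2) A :=
    ((by fun_prop : Continuous fun ξ : E => ‖ξ‖ ^ 2).continuousOn.integrableOn_compact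
      (isCompact_closedBall 0 R)).mono_set hAsub
  obtain ⟨h1, h2⟩ := (convex_Icc (r ^ 2) (R ^ 2)).set_average_mem isClosed_Icc hA0 hAtop
    ((ae_restrict_iff' hAm).2 (.of_forall fun ξ hξ => (⟨pow_le_pow_left₀ hr hξ.1 2,
      pow_le_pow_left₀ (norm_nonneg ξ) hξ.2 2⟩ : ‖ξ‖ ^ 2 ∈ Set.Icc (r ^ 2) (R ^ 2)))) hint
  refine ⟨√(⨍ ξ in A, ‖ξ‖ ^ 2), Real.le_sqrt_of_sq_le h1,
    Real.sqrt_le_iff.2 ⟨hr.trans hrR.le, h2⟩, ?_⟩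
  rw [Real.sq_sqrt ((sq_nonneg r).trans h1)]
  have : IsFiniteMeasure (volume.restrict A) := ⟨by simpa using hAtop.lt_top⟩
  have h3 := integral_sub_average (volume.restrict A) fun ξ : E => ‖ξ‖ ^ 2
  rw [← integral_indicator hAm] at h3
  exact h3

theorem integral_norm_sq_mul_truncCone_le {L r R : ℝ} {F : E → ℝ} (hL : 0 ≤ L) (hr : 0 ≤ r)
    (hrR : r < R) (h0 : ∀ ξ, 0 ≤ F ξ) (hle : ∀ ξ, F ξ ≤ L * (R - r)) (hint : Integrable F)
    (hmass : ∫ ξ, F ξ = ∫ ξ : E, truncCone L r R ξ) (hF : LocallyLipschitz F)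
    (hgrad : ∀ᵐ ξ, ‖gradient F ξ‖ ≤ L) (hint2 : Integrable fun ξ => ‖ξ‖ ^ 2 * F ξ) :
    ∫ ξ : E, ‖ξ‖ ^ 2 * truncCone L r R ξ ≤ ∫ ξ, ‖ξ‖ ^ 2 * F ξ := by
  obtain ⟨s, hrs, hsR, hs⟩ := exists_integral_annulus_eq_zero (E := E) hr hrR
  have hT := integrable_truncCone (E := E) L r R
  have hT2 := integrable_norm_sq_mul_truncCone (E := E) L r R
  -- The minorant of the integrand: the weight times the value of `F - T` at `s • θ`.
  have hzero := integral_mul_radial_eq_zero volume hs fun θ => F (s • θ) - L * (R - s)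
  have hD : Integrable fun ξ => (‖ξ‖ ^ 2 - s ^ 2) * (F ξ - truncCone L r R ξ) := by
    have := (hint2.sub hT2).sub ((hint.sub hT).const_mul (s ^ 2))
    refine this.congr (.of_forall fun ξ => ?_)
    simp only [Pi.sub_apply]
    ring
  -- Equality of the masses removes the contribution of `s ^ 2`.
  have hDint : ∫ ξ, (‖ξ‖ ^ 2 - s ^ 2) * (F ξ - truncCone L r R ξ)
      = ∫ ξ, ‖ξ‖ ^ 2 * F ξ - ‖ξ‖ ^ 2 * truncCone L r R ξ
        - s ^ 2 * (F ξ - truncCone L r R ξ) := by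
    congr 1; ext ξ; ring
  have hE : Integrable fun ξ => ‖ξ‖ ^ 2 * F ξ - ‖ξ‖ ^ 2 * truncCone L r R ξ := hint2.sub hT2
  have hm : Integrable fun ξ => s ^ 2 * (F ξ - truncCone L r R ξ) := (hint.sub hT).const_mul _
  rw [integral_sub hE hm, integral_sub hint2 hT2,
    integral_const_mul, integral_sub hint hT, hmass, sub_self, mul_zero, sub_zero] at hDint
  rw [← sub_nonneg, ← hDint, ← hzero]
  have hmeas : Measurable fun ξ : E => (Set.Icc r R).indicator (fun ρ => ρ ^ 2 - s ^ 2) ‖ξ‖ *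
        (F (s • ‖ξ‖⁻¹ • ξ) - L * (R - s)) := by
    refine ((Measurable.indicator (by fun_prop) measurableSet_Icc).comp measurable_norm).mul ?_
    exact (hF.continuous.measurable.comp (by fun_prop)).sub_const _
  refine integral_mono_ae ?_ hD ?_
  -- The minorant is bounded and supported in the ball of radius `R`.
  · refine Integrable.mono' (g := (Metric.closedBall (0 : E) R).indicator fun _ =>
      R ^ 2 * (L * (R - r))) ?_ hmeas.aestronglyMeasurable (.of_forall fun ξ => ?_)
    · exact (integrable_indicator_iff Metric.isClosed_closedBall.measurableSet).2
        (integrableOn_const measure_closedBall_lt_top.ne)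
    · by_cases hξ : ‖ξ‖ ∈ Set.Icc r R
      · rw [Set.indicator_of_mem hξ, Set.indicator_of_mem (by simpa using hξ.2), norm_mul]
        have h1 : ‖ξ‖ ^ 2 ≤ R ^ 2 := pow_le_pow_left₀ (norm_nonneg ξ) hξ.2 2
        have h2 : s ^ 2 ≤ R ^ 2 := pow_le_pow_left₀ (hr.trans hrs) hsR 2
        have h3 : L * (R - s) ≤ L * (R - r) := mul_le_mul_of_nonneg_left (by linarith) hL
        have h4 : 0 ≤ L * (R - s) := mul_nonneg hL (by linarith)
        refine mul_le_mul ?_ ?_ (norm_nonneg _) (sq_nonneg _)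
        · rw [Real.norm_eq_abs, abs_le]
          constructor <;> linarith [sq_nonneg s, sq_nonneg ‖ξ‖]
        · rw [Real.norm_eq_abs, abs_le]
          constructor <;> linarith [h0 (s • ‖ξ‖⁻¹ • ξ), hle (s • ‖ξ‖⁻¹ • ξ)]
      · rw [Set.indicator_of_notMem hξ, zero_mul, norm_zero]
        exact Set.indicator_nonneg (fun _ _ => mul_nonneg (sq_nonneg _)
          (mul_nonneg hL (by linarith))) _
  · filter_upwards [ae_sub_le_mul_sub hF hgrad] with ξ hξ
    exact calibration_le hr hrs hsR (h0 ξ) (hle ξ) hξ.1 hξ.2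

end Radial

/-- When the cone is truncated at the full height `M`, the truncated cone attains the infimum. -/
theorem sigmaInf_eq {n : ℕ} (hn : 1 ≤ n) {M L r R : ℝ} (hM : 0 < M) (hL : 0 < L) (hr : 0 ≤ r)
    (hRr : L * (R - r) = M) :
    sigmaInf n M L (omegaBall n * L * (R ^ (n + 1) - r ^ (n + 1)) / (n + 1))
      = ENNReal.ofReal (omegaBall n * L * n * (R ^ (n + 3) - r ^ (n + 3)) /
          ((n + 2) * (n + 3))) := by
  have : Nonempty (Fin n) := ⟨⟨0, hn⟩⟩
  have hrR : r < R := sub_pos.1 (pos_of_mul_pos_right (hRr ▸ hM) hL.le)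
  have hA := isAdmissible_truncCone hn hL.le le_rfl hr hrR.le hRr.le
  rw [← lintegral_truncCone hn hL.le hr hrR.le]
  refine le_antisymm (iInf₂_le _ hA) (le_iInf₂ fun F hF => ?_)
  -- A competitor of infinite energy needs no argument.
  by_cases htop : ∫⁻ ξ, ENNReal.ofReal (‖ξ‖ ^ 2 * F ξ) = ⊤
  · rw [htop]
    exact le_top
  have hnn : ∀ ξ, 0 ≤ ‖ξ‖ ^ 2 * F ξ := fun ξ => mul_nonneg (sq_nonneg _) (hF.nonneg ξ)
  have hcont := hF.locallyLipschitz.continuous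
  have hint2 : Integrable fun ξ => ‖ξ‖ ^ 2 * F ξ :=
    (lintegral_ofReal_ne_top_iff_integrable
      (by fun_prop : Continuous fun ξ => ‖ξ‖ ^ 2 * F ξ).aestronglyMeasurable
      (.of_forall hnn)).1 htop
  rw [← ofReal_integral_eq_lintegral_ofReal hint2 (.of_forall hnn),
    ← ofReal_integral_eq_lintegral_ofReal (integrable_norm_sq_mul_truncCone L r R)
      (.of_forall fun ξ => mul_nonneg (sq_nonneg _) (truncCone_nonneg hL.le r R ξ))]
  exact ENNReal.ofReal_le_ofReal (integral_norm_sq_mul_truncCone_le hL.le hr hrR hF.nonneg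
    (fun ξ => (hF.le_bound ξ).trans hRr.ge) hF.integrable
    (hF.integral_eq.trans hA.integral_eq.symm) hF.locallyLipschitz hF.norm_gradient_le hint2)

/-! ### Expansions of the normalized mass and energy -/

section Expansion

open Topology

theorem one_add_rpow_sub_taylor_two_isBigO (α : ℝ) :
    (fun u : ℝ => (1 + u) ^ α - (1 + α * u + α * (α - 1) / 2 * u ^ 2)) =O[𝓝 0]
      fun u => u ^ 3 := by
  have h := (Real.one_add_rpow_hasFPowerSeriesAt_zero (a := α)).isBigO_sub_partialSum_pow 3
  have h2 : Ring.choose α 2 = α * (α - 1) / 2 := by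
    rw [Ring.choose_eq_smul]
    simp [descPochhammer, Polynomial.smeval_sub, Polynomial.smeval_mul]
    ring
  refine (h.congr_left fun u => ?_).trans (.of_bound 1 (.of_forall fun u => ?_))
  · simp [FormalMultilinearSeries.partialSum, Finset.sum_range_succ, binomialSeries,
      FormalMultilinearSeries.coeff_ofScalars, h2]
    ring
  · simp

/-- The binomial expansion to sixth order, with the coefficients written as polynomials in `k`, so
that no case distinction is needed for small `k`. -/
theorem exists_one_add_pow_eq (k : ℕ) : ∃ p : ℝ → ℝ, Continuous p ∧ ∀ s : ℝ,
    (1 + s) ^ k = 1 + k * s + k * (k - 1) / 2 * s ^ 2 + k * (k - 1) * (k - 2) / 6 * s ^ 3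
      + k * (k - 1) * (k - 2) * (k - 3) / 24 * s ^ 4
      + k * (k - 1) * (k - 2) * (k - 3) * (k - 4) / 120 * s ^ 5
      + k * (k - 1) * (k - 2) * (k - 3) * (k - 4) * (k - 5) / 720 * s ^ 6
      + s ^ 7 * p s := by
  induction k with
  | zero => exact ⟨fun _ => 0, continuous_const, fun s => by simp⟩
  | succ k ih =>
    obtain ⟨p, hp, h⟩ := ih
    refine ⟨fun s => (1 + s) * p s
      + k * (k - 1) * (k - 2) * (k - 3) * (k - 4) * (k - 5) / 720, by fun_prop, fun s => ?_⟩
    rw [pow_succ, h]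
    push_cast
    ring

/-- The odd part of `(1 + s) ^ k`, divided by its leading term `k * s`. It has the junk value `0` at
`s = 0`, so that its limits are taken along `𝓝[≠] 0`. -/
noncomputable def symPow (k : ℕ) (s : ℝ) : ℝ := ((1 + s) ^ k - (1 - s) ^ k) / (2 * k * s)

theorem symPow_isBigO {k : ℕ} (hk : 1 ≤ k) :
    (fun s => symPow k s - (1 + ((k : ℝ) - 1) * (k - 2) / 6 * s ^ 2
      + ((k : ℝ) - 1) * (k - 2) * (k - 3) * (k - 4) / 120 * s ^ 4)) =O[𝓝[≠] 0]
      fun s => s ^ 6 := by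
  obtain ⟨p, hp, h⟩ := exists_one_add_pow_eq k
  have hk0 : (k : ℝ) ≠ 0 := by positivity
  have hq : (fun s => (p s + p (-s)) / (2 * k)) =O[𝓝[≠] 0] fun _ => (1 : ℝ) :=
    ((by fun_prop : Continuous fun s => (p s + p (-s)) / (2 * k)).tendsto 0).isBigO_one ℝ
      |>.mono nhdsWithin_le_nhds
  have h6 := (isBigO_refl (fun s : ℝ => s ^ 6) (𝓝[≠] 0)).mul hq
  simp only [mul_one] at h6
  refine h6.congr' ?_ .rfl
  filter_upwards [self_mem_nhdsWithin] with s hs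
  have hs : s ≠ 0 := hs
  have h1 := h s
  have h2 := h (-s)
  rw [← sub_eq_add_neg] at h2
  rw [symPow, h1, h2]
  field_simp
  ring

theorem pow_isBigO_pow_of_le {i j : ℕ} (hij : i ≤ j) :
    (fun s : ℝ => s ^ j) =O[𝓝[≠] 0] fun s => s ^ i := by
  have h : (fun s : ℝ => s ^ (j - i)) =O[𝓝[≠] 0] fun _ => (1 : ℝ) :=
    ((continuous_pow (M := ℝ) (j - i)).tendsto 0).isBigO_one ℝ |>.mono nhdsWithin_le_nhds
  refine ((isBigO_refl (fun s : ℝ => s ^ i) (𝓝[≠] 0)).mul h).congr (fun s => ?_) fun s => ?_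
  · rw [← pow_add, Nat.add_sub_cancel' hij]
  · rw [mul_one]

theorem sub_one_sub_isBigO_of_even_expansion {f : ℝ → ℝ} {p q : ℝ}
    (hf : (fun s => f s - (1 + p * s ^ 2 + q * s ^ 4)) =O[𝓝[≠] 0] fun s => s ^ 6) :
    (fun s => f s - 1 - p * s ^ 2) =O[𝓝[≠] 0] fun s => s ^ 4 :=
  ((hf.trans (pow_isBigO_pow_of_le (by norm_num))).add
    (isBigO_const_mul_self q _ _)).congr_left fun s => by ring

theorem sub_one_isBigO_of_even_expansion {f : ℝ → ℝ} {p q : ℝ}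
    (hf : (fun s => f s - (1 + p * s ^ 2 + q * s ^ 4)) =O[𝓝[≠] 0] fun s => s ^ 6) :
    (fun s => f s - 1) =O[𝓝[≠] 0] fun s => s ^ 2 :=
  (((sub_one_sub_isBigO_of_even_expansion hf).trans (pow_isBigO_pow_of_le (by norm_num))).add
    (isBigO_const_mul_self p _ _)).congr_left fun s => by ring

theorem tendsto_one_of_even_expansion {f : ℝ → ℝ} {p q : ℝ}
    (hf : (fun s => f s - (1 + p * s ^ 2 + q * s ^ 4)) =O[𝓝[≠] 0] fun s => s ^ 6) :
    Tendsto f (𝓝[≠] 0) (𝓝 1) := by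
  have h : Tendsto (fun s : ℝ => s ^ 2) (𝓝[≠] 0) (𝓝 0) :=
    ((continuous_pow (M := ℝ) 2).tendsto' 0 0 (by simp)).mono_left nhdsWithin_le_nhds
  simpa using ((sub_one_isBigO_of_even_expansion hf).trans_tendsto h).add_const 1

theorem rpow_even_expansion {f : ℝ → ℝ} {p q : ℝ}
    (hf : (fun s => f s - (1 + p * s ^ 2 + q * s ^ 4)) =O[𝓝[≠] 0] fun s => s ^ 6) (α : ℝ) :
    (fun s => f s ^ α - (1 + α * p * s ^ 2 + (α * q + α * (α - 1) / 2 * p ^ 2) * s ^ 4))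
      =O[𝓝[≠] 0] fun s => s ^ 6 := by
  have hu := sub_one_isBigO_of_even_expansion hf
  have ht : Tendsto (fun s => f s - 1) (𝓝[≠] 0) (𝓝 0) := by
    simpa using (tendsto_one_of_even_expansion hf).sub_const 1
  have h1 : (fun s => (1 + (f s - 1)) ^ α - (1 + α * (f s - 1)
      + α * (α - 1) / 2 * (f s - 1) ^ 2)) =O[𝓝[≠] 0] fun s => s ^ 6 :=
    ((one_add_rpow_sub_taylor_two_isBigO α).comp_tendsto ht).trans
      ((hu.pow 3).congr_right fun s => by ring)
  -- The difference `(f s - 1) ^ 2 - p ^ 2 * s ^ 4`, factored.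
  have h2 : (fun s => (f s - 1 - p * s ^ 2) * (f s - 1 + p * s ^ 2)) =O[𝓝[≠] 0]
      fun s => s ^ 6 :=
    ((sub_one_sub_isBigO_of_even_expansion hf).mul
      (hu.add (isBigO_const_mul_self p _ _))).congr_right
      fun s => by ring
  refine ((h1.add (hf.const_mul_left α)).add
    (h2.const_mul_left (α * (α - 1) / 2))).congr_left fun s => ?_
  rw [add_sub_cancel]
  ring

/-- The normalized form of the expansion: the energy minus the three terms, both divided by
`ω * M * x ^ (n + 2)`, as functions of `s = M / (2 * L * x)`. All terms of order less than six
cancel. -/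
theorem energy_expansion_isBigO {n : ℕ} (hn : 1 ≤ n) :
    (fun s => (n : ℝ) / (n + 2) * (symPow (n + 3) s - symPow (n + 1) s ^ (1 + 2 / (n : ℝ)))
      - n / 3 * s ^ 2 * symPow (n + 1) s
      + n * (n - 1) * (3 * n + 2) / 90 * s ^ 4 * symPow (n + 1) s ^ (1 - 2 / (n : ℝ)))
      =O[𝓝[≠] 0] fun s => s ^ 6 := by
  have hn0 : (n : ℝ) ≠ 0 := by positivity
  have hn2 : (n : ℝ) + 2 ≠ 0 := by positivity
  have hP := symPow_isBigO (k := n + 1) (by omega)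
  have hQ := symPow_isBigO (k := n + 3) (by omega)
  have hα := rpow_even_expansion hP (1 + 2 / (n : ℝ))
  have hβ := sub_one_isBigO_of_even_expansion (rpow_even_expansion hP (1 - 2 / (n : ℝ)))
  have h1 := ((isBigO_refl (fun s : ℝ => s ^ 2) (𝓝[≠] 0)).mul
    (sub_one_sub_isBigO_of_even_expansion hP)).congr_right
    (g₂ := fun s => s ^ 6) fun s => by ring
  have h2 := ((isBigO_refl (fun s : ℝ => s ^ 4) (𝓝[≠] 0)).mul hβ).congr_right
    (g₂ := fun s => s ^ 6) fun s => by ring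
  refine ((((hQ.const_mul_left ((n : ℝ) / (n + 2))).sub
    (hα.const_mul_left ((n : ℝ) / (n + 2)))).sub (h1.const_mul_left ((n : ℝ) / 3))).add
    (h2.const_mul_left ((n : ℝ) * (n - 1) * (3 * n + 2) / 90))).congr_left fun s => ?_
  generalize symPow (n + 1) s ^ (1 + 2 / (n : ℝ)) = A
  generalize symPow (n + 1) s ^ (1 - 2 / (n : ℝ)) = B
  push_cast
  field_simp
  ring

end Expansion

/-! ### The asymptotic expansion of the infimum -/

section Parametrization

open Topology

theorem sub_pow_eq_symPow {x a : ℝ} (hx : x ≠ 0) (ha : a ≠ 0) {k : ℕ} (hk : k ≠ 0) :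
    (x + a) ^ k - (x - a) ^ k = 2 * k * (a / x) * x ^ k * symPow k (a / x) := by
  have h1 : x + a = x * (1 + a / x) := by field_simp
  have h2 : x - a = x * (1 - a / x) := by field_simp
  have hk' : (k : ℝ) ≠ 0 := by exact_mod_cast hk
  rw [symPow, h1, h2, mul_pow, mul_pow]
  field_simp

/-- The mass of the truncated cone of slope `L` and height `M` with mean radius `x`, that is with
`r = x - M / (2 * L)` and `R = x + M / (2 * L)`. -/
noncomputable def coneMass (n : ℕ) (M L x : ℝ) : ℝ :=
  omegaBall n * L * ((x + M / (2 * L)) ^ (n + 1) - (x - M / (2 * L)) ^ (n + 1)) / (n + 1)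

/-- The energy `∫ ‖ξ‖ ^ 2 * T ξ` of the truncated cone `T` of slope `L` and height `M` with mean
radius `x`. -/
noncomputable def coneEnergy (n : ℕ) (M L x : ℝ) : ℝ :=
  omegaBall n * L * n * ((x + M / (2 * L)) ^ (n + 3) - (x - M / (2 * L)) ^ (n + 3)) /
    ((n + 2) * (n + 3))

variable {n : ℕ} {M L x : ℝ}

theorem coneMass_eq (hM : 0 < M) (hL : 0 < L) (hx : 0 < x) :
    coneMass n M L x
      = omegaBall n * M * x ^ n * symPow (n + 1) (M / (2 * L) / x) := by
  have ha : M / (2 * L) ≠ 0 := by positivity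
  rw [coneMass, sub_pow_eq_symPow hx.ne' ha (by omega)]
  push_cast
  field_simp
  ring

theorem coneEnergy_eq (hM : 0 < M) (hL : 0 < L) (hx : 0 < x) :
    coneEnergy n M L x
      = omegaBall n * M * x ^ (n + 2) * (n / (n + 2) * symPow (n + 3) (M / (2 * L) / x)) := by
  have ha : M / (2 * L) ≠ 0 := by positivity
  rw [coneEnergy, sub_pow_eq_symPow hx.ne' ha (by omega)]
  push_cast
  field_simp
  ring

theorem sigmaInf_coneMass (hn : 1 ≤ n) (hM : 0 < M) (hL : 0 < L) (hx : M / (2 * L) ≤ x) :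
    (sigmaInf n M L (coneMass n M L x)).toReal = coneEnergy n M L x := by
  have ha : 0 < M / (2 * L) := by positivity
  rw [coneMass, sigmaInf_eq hn hM hL (sub_nonneg.2 hx) (by field_simp; ring), ENNReal.toReal_ofReal,
    coneEnergy]
  have h : (x - M / (2 * L)) ^ (n + 3) ≤ (x + M / (2 * L)) ^ (n + 3) :=
    pow_le_pow_left₀ (sub_nonneg.2 hx) (by linarith) _
  have := omegaBall_pos n
  have := sub_nonneg.2 h
  positivity

theorem tendsto_div_atTop_nhdsNE {a : ℝ} (ha : a ≠ 0) :
    Tendsto (fun x => a / x) atTop (𝓝[≠] 0) :=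
  tendsto_nhdsWithin_iff.2 ⟨tendsto_const_nhds.div_atTop tendsto_id,
    (eventually_ne_atTop 0).mono fun _ hx => div_ne_zero ha hx⟩

theorem tendsto_symPow_div {a : ℝ} (ha : a ≠ 0) {k : ℕ} (hk : 1 ≤ k) :
    Tendsto (fun x => symPow k (a / x)) atTop (𝓝 1) :=
  (tendsto_one_of_even_expansion (symPow_isBigO hk)).comp (tendsto_div_atTop_nhdsNE ha)

theorem tendsto_coneMass (hn : 1 ≤ n) (hM : 0 < M) (hL : 0 < L) :
    Tendsto (coneMass n M L) atTop atTop := by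
  have ha : M / (2 * L) ≠ 0 := by positivity
  have hW : 0 < omegaBall n * M := mul_pos (omegaBall_pos n) hM
  refine (((tendsto_pow_atTop (by omega : n ≠ 0)).const_mul_atTop hW).atTop_mul_pos one_pos
    (tendsto_symPow_div ha (by omega : 1 ≤ n + 1))).congr' ?_
  filter_upwards [eventually_gt_atTop 0] with x hx
  exact (coneMass_eq hM hL hx).symm

/-- A property of `f x` that holds for all large `x` holds for all large real numbers, by the
intermediate value theorem. -/
theorem atTop_le_map_atTop_of_continuous {f : ℝ → ℝ} (hf : Continuous f)
    (h : Tendsto f atTop atTop) : atTop ≤ map f atTop := by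
  intro s hs
  obtain ⟨x₀, hx₀⟩ := mem_atTop_sets.1 (mem_map.1 hs)
  refine mem_atTop_sets.2 ⟨f x₀, fun y hy => ?_⟩
  obtain ⟨x₁, hx₁, hy₁⟩ := ((eventually_ge_atTop x₀).and (h.eventually_ge_atTop y)).exists
  obtain ⟨x, hx, rfl⟩ := intermediate_value_Icc hx₁ hf.continuousOn ⟨hy, hy₁⟩
  exact hx₀ x hx.1

theorem pow_rpow_div {x : ℝ} (hx : 0 ≤ x) {n : ℕ} (hn : n ≠ 0) (j : ℕ) :
    (x ^ n) ^ ((j : ℝ) / n) = x ^ j := by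
  rw [← Real.rpow_natCast x n, ← Real.rpow_mul hx, mul_div_cancel₀ _ (by exact_mod_cast hn),
    Real.rpow_natCast]

theorem mul_pow_mul_rpow_one_add {W x P : ℝ} (hW : 0 < W) (hx : 0 < x) (hP : 0 < P) {n : ℕ}
    (hn : n ≠ 0) (j : ℕ) :
    (W * x ^ n * P) ^ (1 + (j : ℝ) / n)
      = W * W ^ ((j : ℝ) / n) * (x ^ n * x ^ j) * P ^ (1 + (j : ℝ) / n) := by
  have hxn : 0 < x ^ n := pow_pos hx n
  rw [Real.mul_rpow (by positivity) hP.le, Real.mul_rpow hW.le hxn.le, Real.rpow_add hW,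
    Real.rpow_add hxn, Real.rpow_one, Real.rpow_one, pow_rpow_div hx.le hn]

theorem mul_pow_mul_rpow_one_sub {W x P : ℝ} (hW : 0 < W) (hx : 0 < x) (hP : 0 < P) {n : ℕ}
    (hn : n ≠ 0) (j : ℕ) :
    (W * x ^ n * P) ^ (1 - (j : ℝ) / n)
      = W / W ^ ((j : ℝ) / n) * (x ^ n / x ^ j) * P ^ (1 - (j : ℝ) / n) := by
  have hxn : 0 < x ^ n := pow_pos hx n
  rw [Real.mul_rpow (by positivity) hP.le, Real.mul_rpow hW.le hxn.le, Real.rpow_sub hW,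
    Real.rpow_sub hxn, Real.rpow_one, Real.rpow_one, pow_rpow_div hx.le hn]

theorem coneEnergy_sub_sigmaZero (hn : 1 ≤ n) (hM : 0 < M) (hL : 0 < L) (hx : 0 < x)
    (hP : 0 < symPow (n + 1) (M / (2 * L) / x)) :
    coneEnergy n M L x - sigmaZero n M L (coneMass n M L x)
      = omegaBall n * M * x ^ (n + 2) *
        ((n : ℝ) / (n + 2) * (symPow (n + 3) (M / (2 * L) / x)
            - symPow (n + 1) (M / (2 * L) / x) ^ (1 + 2 / (n : ℝ)))
          - n / 3 * (M / (2 * L) / x) ^ 2 * symPow (n + 1) (M / (2 * L) / x)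
          + n * (n - 1) * (3 * n + 2) / 90 * (M / (2 * L) / x) ^ 4 *
            symPow (n + 1) (M / (2 * L) / x) ^ (1 - 2 / (n : ℝ))) := by
  have hω := omegaBall_pos n
  have hW : 0 < omegaBall n * M := mul_pos hω hM
  have h1 := mul_pow_mul_rpow_one_add hW hx hP (by omega : n ≠ 0) 2
  have h2 := mul_pow_mul_rpow_one_sub hW hx hP (by omega : n ≠ 0) 2
  have hWt := Real.rpow_pos_of_pos hW (2 / (n : ℝ))
  push_cast at h1 h2
  rw [coneEnergy_eq hM hL hx, coneMass_eq hM hL hx, sigmaZero, leadingTerm, secondTerm, thirdTerm,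
    h1, h2, one_div, Real.inv_rpow hW.le, mul_comm M (omegaBall n)]
  generalize symPow (n + 1) (M / (2 * L) / x) ^ (1 + 2 / (n : ℝ)) = A
  generalize symPow (n + 1) (M / (2 * L) / x) ^ (1 - 2 / (n : ℝ)) = B
  generalize symPow (n + 1) (M / (2 * L) / x) = P
  generalize symPow (n + 3) (M / (2 * L) / x) = Q
  generalize (omegaBall n * M) ^ (2 / (n : ℝ)) = T at hWt
  field_simp
  ring

theorem coneEnergy_sub_sigmaZero_isBigO (hn : 1 ≤ n) (hM : 0 < M) (hL : 0 < L) :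
    (fun x => coneEnergy n M L x - sigmaZero n M L (coneMass n M L x))
      =O[atTop] fun x => coneMass n M L x ^ (1 - 4 / (n : ℝ)) := by
  have ha : M / (2 * L) ≠ 0 := by positivity
  have hW : 0 < omegaBall n * M := mul_pos (omegaBall_pos n) hM
  have hlim := tendsto_symPow_div ha (by omega : 1 ≤ n + 1)
  have hH := ((energy_expansion_isBigO hn).comp_tendsto (tendsto_div_atTop_nhdsNE ha))
  have hH' := (isBigO_refl (fun x : ℝ => omegaBall n * M * x ^ (n + 2)) atTop).mul hH
  have hinv : (fun x => (symPow (n + 1) (M / (2 * L) / x) ^ (1 - 4 / (n : ℝ)))⁻¹)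
      =O[atTop] fun _ => (1 : ℝ) := by
    have h1 := (hlim.rpow_const (p := 1 - 4 / (n : ℝ)) (Or.inl one_ne_zero)).inv₀ (by simp)
    exact h1.isBigO_one ℝ
  have hC := ((isBigO_refl (fun x => coneMass n M L x ^ (1 - 4 / (n : ℝ))) atTop).mul
    hinv).const_mul_left ((omegaBall n * M) ^ (4 / (n : ℝ)) * (M / (2 * L)) ^ 6)
  simp only [mul_one] at hC
  have hev : ∀ᶠ x in atTop, 0 < x ∧ 0 < symPow (n + 1) (M / (2 * L) / x) :=
    (eventually_gt_atTop 0).and (hlim.eventually_const_lt one_pos)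
  refine (hH'.congr' ?_ ?_).trans hC
  · filter_upwards [hev] with x hx
    exact (coneEnergy_sub_sigmaZero hn hM hL hx.1 hx.2).symm
  · filter_upwards [hev] with x hx
    obtain ⟨hx, hP⟩ := hx
    have h := mul_pow_mul_rpow_one_sub hW hx hP (by omega : n ≠ 0) 4
    push_cast at h
    have hPt := Real.rpow_pos_of_pos hP (1 - 4 / (n : ℝ))
    have hWt := Real.rpow_pos_of_pos hW (4 / (n : ℝ))
    rw [coneMass_eq hM hL hx, h]
    simp only [Function.comp_apply]
    generalize symPow (n + 1) (M / (2 * L) / x) ^ (1 - 4 / (n : ℝ)) = A at hPt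
    generalize (omegaBall n * M) ^ (4 / (n : ℝ)) = T at hWt
    field_simp
    ring

end Parametrization

theorem sigmaInf_sub_sigmaZero_isBigO {n : ℕ} (hn : 1 ≤ n) {M L : ℝ} (hM : 0 < M) (hL : 0 < L) :
    (fun m : ℝ => (sigmaInf n M L m).toReal - sigmaZero n M L m)
      =O[atTop] fun m : ℝ => m ^ (1 - 4 / (n : ℝ)) := by
  have hcont : Continuous (coneMass n M L) := by unfold coneMass; fun_prop
  refine IsBigO.mono (isBigO_map.2 ?_)
    (atTop_le_map_atTop_of_continuous hcont (tendsto_coneMass hn hM hL))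
  refine (coneEnergy_sub_sigmaZero_isBigO hn hM hL).congr' ?_ .rfl
  filter_upwards [eventually_ge_atTop (M / (2 * L))] with x hx
  simp only [Function.comp_apply, sigmaInf_coneMass hn hM hL hx]

theorem mainTheorem4 (n : ℕ) (hn : 1 ≤ n) (M L : ℝ) (hM : 0 < M) (hL : 0 < L) :
    (∀ m : ℝ, 0 < m → sigmaInf n M L m ≠ ⊤) ∧
    ((fun m : ℝ => (sigmaInf n M L m).toReal - sigmaZero n M L m)
      =O[atTop] fun m : ℝ => m ^ (1 - 4 / (n : ℝ))) ∧
    (∃ c : ℝ, 0 < c ∧ ∀ m : ℝ, secondTerm n M L m = c * m) ∧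
    (∀ m : ℝ, 0 < m → 0 < secondTerm n M L m) ∧
    (2 ≤ n → ∀ m : ℝ, 0 < m → thirdTerm n M L m < 0) ∧
    (n = 1 → ∀ m : ℝ, 0 < m → thirdTerm n M L m = 0) := by
  have hn0 : (0 : ℝ) < n := by exact_mod_cast hn
  have hc : 0 < (n : ℝ) / 12 * (M ^ 2 / L ^ 2) := by positivity
  refine ⟨fun m hm => sigmaInf_ne_top hn hM hL hm, sigmaInf_sub_sigmaZero_isBigO hn hM hL,
    ⟨_, hc, fun m => rfl⟩, fun m hm => mul_pos hc hm, fun h2 m hm => ?_, ?_⟩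
  · have h1 : (0 : ℝ) < n - 1 := sub_pos.2 (by exact_mod_cast h2)
    have hω := omegaBall_pos n
    rw [thirdTerm, neg_lt_zero]
    positivity
  · rintro rfl m -
    simp [thirdTerm]
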